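/- \textbf{Conventions.} Let $Y$ be a normed space over $\mathbf C$ (not necessarily complete). A multivalued map $F:Y\to Y$ assigns to each $x\in Y$ a nonempty set $F(x)\subset Y$; the composition is $(GF)(x)=\bigcup_{y\in F(x)}G(y)$, inverse images are $F^{-1}(B)=\{x: F(x)\cap B\ne\emptyset\}$, with $F^{-1}(0)=F^{-1}(\{0\})$, and inclusions or equalities of maps hold pointwise. $F$ is \emph{upper semicontinuous} (u.s.c.) if for every $x\in Y$ and $\varepsilon>0$ there is $\delta>0$ such that $\|y-x\|<\delta$ implies that $F(y)$ lies in the open $\varepsilon$-neighbourhood of $F(x)$ (this holds in particular if $F^{-1}(B)$ is closed for every closed $B$); $F$ is \emph{lower semicontinuous} if $F^{-1}(B)$ is open for every open $B$, and \emph{continuous} if it is both. A \emph{linear relation} on $Y$ is a multivalued map $h:Y\to Y$ with $h(ax+by)=ah(x)+bh(y)$ for all $x,y\in Y$ and all $a,b\in\mathbf C\setminus\{0\}$; then $h(0)$ is a linear subspace. For a linear relation $h$, let $Comm(h)$ be the set of all continuous linear relations $g$ on $Y$ with $\dim g(0)<\infty$ and $hg\subset gh$. Such a $g$ is \emph{compact}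 if its composition with the quotient map $Y\to Y/g(0)$ maps every bounded set into a compact set. \textbf{Theorem (Invariant Subspaces).} Let $Y$ be a normed space over $\mathbf C$, and let $h$ be an u.s.c. linear relation on $Y$ such that for no $\lambda\in\mathbf C$ is $\lambda\,\mathrm{Id}$ a selection of $h$ (that is, for no $\lambda$ do we have $\lambda x\in h(x)$ for all $x\in Y$). Let $k\in Comm(h)$ be compact with $k^{-1}(0)\neq Y$. If a bounded linear operator $f:Y\to Y$ strictly commutes with $h$, i.e. $fh=hf$, and $h(0)\subset f(k(0))$, then there is a nontrivial closed $f$-invariant subspace, i.e. a closed linear subspace $M\subset Y$ with $M\ne\{0\}$, $M\neq Y$ and $f(M)\subset M$. -/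

import Mathlib

open scoped Pointwise

/-! Multivalued maps `X → Y` are functions `X → Set Y`. -/

/-- The composition `x ↦ G (F x) = ⋃ y ∈ F x, G y` of multivalued maps. -/
def mcomp {X Y Z : Type*} (G : Y → Set Z) (F : X → Set Y) : X → Set Z :=
  fun x => ⋃ y ∈ F x, G y

/-- The inverse image `{x | F x ∩ B ≠ ∅}` of a set under a multivalued map. -/
def mpreimage {X Y : Type*} (F : X → Set Y) (B : Set Y) : Set X :=
  {x | (F x ∩ B).Nonempty}

/-- `g` is a (single-valued) selection of `F`. -/
def IsSelection {X Y : Type*} (g : X → Y) (F : X → Set Y) : Prop :=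
  ∀ x, g x ∈ F x

/-- `h` and `k` commute (in this order): `h k ⊆ k h`. -/
def MCommute {Y : Type*} (h k : Y → Set Y) : Prop :=
  ∀ x, mcomp h k x ⊆ mcomp k h x

/-- `h` and `k` strictly commute: `k h = h k`. -/
def MStrictlyCommute {Y : Type*} (h k : Y → Set Y) : Prop :=
  mcomp k h = mcomp h k

/-- Upper semicontinuity of a multivalued map between metric spaces:
for every `x` and `ε > 0`, all values `F y` with `y` near `x` lie in the open
`ε`-neighbourhood of `F x`. -/
def IsUSC {X Y : Type*} [PseudoMetricSpace X] [PseudoMetricSpace Y] (F : X → Set Y) : Prop :=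
  ∀ x, ∀ ε > 0, ∃ δ > 0, ∀ y, dist y x < δ → F y ⊆ Metric.thickening ε (F x)

/-- The topological form of upper semicontinuity (inverse images of closed sets are closed)
implies the metric form, so assuming `IsUSC` is assuming less. The topological form is too
strong for relations with unbounded values: `x ↦ k x + N`, with `k` a bounded operator and
`N ≠ 0` a finite-dimensional subspace not containing the range of `k`, never has it. -/
theorem IsUSC.of_isClosed_mpreimage {X Y : Type*} [PseudoMetricSpace X] [PseudoMetricSpace Y]
    {F : X → Set Y} (hF : ∀ B : Set Y, IsClosed B → IsClosed (mpreimage F B)) : IsUSC F := by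
  intro x ε hε
  have hcl := hF (Metric.thickening ε (F x))ᶜ Metric.isOpen_thickening.isClosed_compl
  have hx : x ∈ (mpreimage F (Metric.thickening ε (F x))ᶜ)ᶜ := by
    rintro ⟨z, hz, hz'⟩
    exact hz' (Metric.self_subset_thickening hε _ hz)
  obtain ⟨δ, hδ, hball⟩ := Metric.isOpen_iff.1 hcl.isOpen_compl x hx
  refine ⟨δ, hδ, fun y hy z hz => ?_⟩
  by_contra hcon
  exact hball (Metric.mem_ball.2 hy) ⟨z, hz, hcon⟩

/-- Lower semicontinuity: inverse images of open sets are open. -/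
def IsLSC {X Y : Type*} [TopologicalSpace X] [TopologicalSpace Y] (F : X → Set Y) : Prop :=
  ∀ B : Set Y, IsOpen B → IsOpen (mpreimage F B)

/-- Linear relations: multivalued maps with nonempty values that preserve linear combinations
with nonzero coefficients. -/
structure LinRel (𝕜 X Y : Type*) [Field 𝕜] [AddCommGroup X] [Module 𝕜 X]
    [AddCommGroup Y] [Module 𝕜 Y] where
  toFun : X → Set Y
  nonempty' : ∀ x, (toFun x).Nonempty
  map_comb' : ∀ (x y : X) (a b : 𝕜), a ≠ 0 → b ≠ 0 →
    toFun (a • x + b • y) = a • toFun x + b • toFun y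

namespace LinRel

section Algebra

variable {𝕜 X Y : Type*} [Field 𝕜] [AddCommGroup X] [Module 𝕜 X] [AddCommGroup Y] [Module 𝕜 Y]

instance : CoeFun (LinRel 𝕜 X Y) (fun _ => X → Set Y) := ⟨LinRel.toFun⟩

/-- The linear subspace `T(0)`. -/
def zeroValue (T : LinRel 𝕜 X Y) : Submodule 𝕜 Y :=
  have hadd : ∀ {a b : 𝕜} {u v : Y}, a ≠ 0 → b ≠ 0 → u ∈ T 0 → v ∈ T 0 →
      a • u + b • v ∈ T 0 := by
    intro a b u v ha hb hu hv
    have h := T.map_comb' 0 0 a b ha hb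
    rw [smul_zero, smul_zero, add_zero] at h
    rw [h]
    exact Set.add_mem_add (Set.smul_mem_smul_set hu) (Set.smul_mem_smul_set hv)
  have hzero : (0 : Y) ∈ T 0 := by
    obtain ⟨u, hu⟩ := T.nonempty' 0
    simpa using hadd (a := 1) (b := -1) one_ne_zero (neg_ne_zero.2 one_ne_zero) hu hu
  { carrier := T 0
    add_mem' := fun {u v} hu hv => by
      simpa using hadd (a := 1) (b := 1) one_ne_zero one_ne_zero hu hv
    zero_mem' := hzero
    smul_mem' := fun c u hu => by
      rcases eq_or_ne c 0 with rfl | hc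
      · simpa using hzero
      · simpa using hadd (b := 1) hc one_ne_zero hu hzero }

end Algebra

section Normed

variable {𝕜 X Y : Type*} [NontriviallyNormedField 𝕜] [NormedAddCommGroup X] [NormedSpace 𝕜 X]
  [NormedAddCommGroup Y] [NormedSpace 𝕜 Y]

/-- The class of continuous linear relations (upper and lower semicontinuous) `T` for which
`T(0)` is finite-dimensional. -/
def IsLR₀ (T : LinRel 𝕜 X Y) : Prop :=
  IsUSC T ∧ IsLSC T ∧ FiniteDimensional 𝕜 T.zeroValue

/-- `T` is compact: composed with the quotient map `Y → Y / T(0)` it maps every bounded set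
into a compact set. -/
def IsCompactRel (T : LinRel 𝕜 X Y) : Prop :=
  ∀ B : Set X, Bornology.IsBounded B →
    ∃ C : Set (Y ⧸ T.zeroValue), IsCompact C ∧ T.zeroValue.mkQ '' (⋃ x ∈ B, T x) ⊆ C

/-- `Comm(h)`: the continuous linear relations `g` with `g(0)` finite-dimensional and
`h g ⊆ g h`. -/
def Comm (h : LinRel 𝕜 Y Y) : Set (LinRel 𝕜 Y Y) :=
  {g | g.IsLR₀ ∧ MCommute h g}

end Normed

end LinRel

/-! ### No smooth retraction of the ball onto its sphere. -/

section Brouwer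

open MeasureTheory Metric Set

variable {E : Type*} [NormedAddCommGroup E] [InnerProductSpace ℝ E] [FiniteDimensional ℝ E]

/-! If `h 0 ≠ {0}`, it is itself the subspace: it is finite-dimensional, being contained in `f (k
0)`, and `f (h 0) = h 0`. Otherwise upper semicontinuity makes `h` a bounded operator `H`, nonscalar
and commuting with `f`; an eigenvector of `H` then suffices, since its eigenspace is proper, closed
and `f`-invariant. If `k 0 ≠ {0}`, this finite-dimensional space is `H`-invariant and contains an
eigenvector. If `k 0 = {0}`, `k` is a nonzero compact operator commuting with `H`, and Lomonosov's
argument applies.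

That argument (`exists_commute_fixed_vector`) assumes `f` has no invariant subspace, so the
commutant of `H` moves every nonzero vector densely. Schauder's theorem gives `a` in the commutant
such that `a k` has a nonzero fixed vector; the fixed space is finite-dimensional and `H`-invariant,
so it contains an eigenvector. No completeness is needed. Schauder is reduced to Brouwer, and
Brouwer to a volume argument: `∫ det (1 + t A)` is polynomial in `t` and equals the volume of the
ball for small `t`, yet vanishes at `t = 1` for a retraction. -/

theorem ContinuousLinearMap.det_one_add_smul_pos (A : E →L[ℝ] E) (t : ℝ) (ht : 0 ≤ t)
    (hA : t * ‖A‖ < 1) : 0 < (1 + t • A).det := by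
  have hcont : Continuous fun s : ℝ => (1 + s • A).det :=
    ContinuousLinearMap.continuous_det.comp (by fun_prop)
  have hne : ∀ s ∈ Icc 0 t, (1 + s • A).det ≠ 0 := by
    intro s hs h0
    obtain ⟨x, hx, hx0⟩ := (Submodule.ne_bot_iff _).1
      (LinearMap.bot_lt_ker_of_det_eq_zero (f := ((1 + s • A : E →L[ℝ] E) : E →ₗ[ℝ] E)) h0).ne'
    have hx' : x + s • A x = 0 := by simpa using hx
    have h1 : ‖x‖ = s * ‖A x‖ := by
      conv_lhs => rw [eq_neg_of_add_eq_zero_left hx', norm_neg, norm_smul, Real.norm_of_nonneg hs.1]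
    have h2 : s * ‖A x‖ ≤ (t * ‖A‖) * ‖x‖ := by
      calc s * ‖A x‖ ≤ t * (‖A‖ * ‖x‖) :=
            mul_le_mul hs.2 (A.le_opNorm x) (norm_nonneg _) ht
        _ = _ := by ring
    have h3 : 0 < ‖x‖ := norm_pos_iff.2 hx0
    nlinarith
  by_contra! hneg
  obtain ⟨s, hs, hs0⟩ := intermediate_value_Icc' ht hcont.continuousOn
    (show (0 : ℝ) ∈ Icc _ _ from ⟨hneg, by simp [ContinuousLinearMap.det]⟩)
  exact hne s hs hs0

theorem LinearMap.exists_polynomial_det_one_add_smul (A : E →ₗ[ℝ] E) :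
    ∃ p : Polynomial ℝ, p.degree < (Module.finrank ℝ E + 1 : ℕ) ∧
      ∀ t : ℝ, p.eval t = LinearMap.det (1 + t • A) := by
  classical
  let b := Module.finBasis ℝ E
  let M := LinearMap.toMatrix b b A
  refine ⟨Matrix.det ((Polynomial.X : Polynomial ℝ) • M.map Polynomial.C +
    (1 : Matrix _ _ ℝ).map Polynomial.C), ?_, fun t => ?_⟩
  · refine lt_of_le_of_lt Polynomial.degree_le_natDegree ?_
    have := Polynomial.natDegree_det_X_add_C_le M 1
    rw [Fintype.card_fin] at this
    exact_mod_cast Nat.lt_succ_of_le this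
  · rw [← LinearMap.det_toMatrix b, ← Polynomial.coe_evalRingHom, RingHom.map_det]
    congr 1
    ext i j
    simp [M, Matrix.one_apply, LinearMap.toMatrix_one, add_comm, mul_comm t, apply_ite (Polynomial.eval t)]

/-- Values of a determinant pencil at `1` are a fixed combination of its values at small points. -/
theorem exists_nodes_det_one_add (ε : ℝ) (hε : 0 < ε) :
    ∃ (s : Finset ℕ) (v w : ℕ → ℝ), (∀ i, 0 < v i ∧ v i ≤ ε) ∧ ∑ i ∈ s, w i = 1 ∧
      ∀ A : E →L[ℝ] E, (1 + A).det = ∑ i ∈ s, w i * (1 + v i • A).det := by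
  classical
  let s := Finset.range (Module.finrank ℝ E + 1)
  -- Distinct nodes in `(0, ε]`, one more than the degree bound, so Lagrange interpolation is exact.
  let v : ℕ → ℝ := fun i => ε / (i + 1)
  have hv : Set.InjOn v s := by
    intro i _ j _ hij
    simp only [v] at hij
    rw [div_eq_div_iff (by positivity) (by positivity)] at hij
    have := mul_left_cancel₀ hε.ne' hij
    exact_mod_cast (add_right_cancel this).symm
  refine ⟨s, v, fun i => (Lagrange.basis s v i).eval 1, fun i => ⟨by positivity, ?_⟩, ?_, ?_⟩
  · exact div_le_self hε.le (by simp)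
  · rw [← Polynomial.eval_finsetSum, Lagrange.sum_basis hv ⟨0, by simp [s]⟩, Polynomial.eval_one]
  · intro A
    obtain ⟨p, hp, hpe⟩ := LinearMap.exists_polynomial_det_one_add_smul (A : E →ₗ[ℝ] E)
    have h := Lagrange.eq_interpolate (f := p) hv (by simpa [s] using hp)
    have h1 : p.eval 1 = ∑ i ∈ s, p.eval (v i) * (Lagrange.basis s v i).eval 1 := by
      conv_lhs => rw [h]
      simp [Lagrange.interpolate_apply, Polynomial.eval_finsetSum]
    rw [hpe] at h1
    simp only [hpe, one_smul] at h1
    rw [ContinuousLinearMap.det]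
    simpa [ContinuousLinearMap.det, mul_comm] using h1

/-- A Lipschitz perturbation of the identity fixing the unit sphere maps the unit ball
bijectively onto itself. -/
theorem bijOn_closedBall_add_of_lipschitz {u : E → E} {L : NNReal}
    (hu : LipschitzOnWith L u (closedBall 0 1)) (hu1 : ∀ x, ‖x‖ = 1 → u x = 0)
    (hL : L < 1) : BijOn (fun x => x + u x) (closedBall 0 1) (closedBall 0 1) := by
  classical
  -- Extension by zero keeps the constant `L`: a segment leaving the ball crosses the sphere, where
  -- `u = 0`. Then `x + U x` is a bijection of `E` that is the identity outside the ball.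
  let U : E → E := fun x => if ‖x‖ ≤ 1 then u x else 0
  have hUin : ∀ x, ‖x‖ ≤ 1 → U x = u x := fun x hx => if_pos hx
  have hUout : ∀ x, ¬ ‖x‖ ≤ 1 → U x = 0 := fun x hx => if_neg hx
  have key : ∀ x y, ‖x‖ ≤ 1 → ¬ ‖y‖ ≤ 1 → dist (U x) (U y) ≤ L * dist x y := by
    intro x y hx hy
    have hc : Continuous fun s : ℝ => ‖AffineMap.lineMap x y s‖ := by
      simp only [AffineMap.lineMap_apply_module']; fun_prop
    obtain ⟨s, hs, hs1⟩ := intermediate_value_Icc (zero_le_one' ℝ) hc.continuousOn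
      (show (1 : ℝ) ∈ Icc _ _ from ⟨by simpa using hx, by simpa using (not_le.1 hy).le⟩)
    set z := AffineMap.lineMap x y s with hz
    have h1 : dist (U x) (U y) = dist (u x) (u z) := by
      rw [hUin x hx, hUout y hy, hu1 z hs1]
    rw [h1]
    refine (hu.dist_le_mul x (by simpa using hx) z (by simpa using hs1.le)).trans ?_
    gcongr
    rw [hz, dist_left_lineMap, Real.norm_of_nonneg hs.1]
    exact mul_le_of_le_one_left dist_nonneg hs.2
  have hU : LipschitzWith L U := by
    refine LipschitzWith.of_dist_le_mul fun x y => ?_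
    by_cases hx : ‖x‖ ≤ 1 <;> by_cases hy : ‖y‖ ≤ 1
    · rw [hUin x hx, hUin y hy]
      exact hu.dist_le_mul x (by simpa using hx) y (by simpa using hy)
    · exact key x y hx hy
    · rw [dist_comm, dist_comm x]; exact key y x hy hx
    · rw [hUout x hx, hUout y hy, dist_self]; positivity
  have happ : ApproximatesLinearOn (fun x => x + U x)
      ((ContinuousLinearEquiv.refl ℝ E : E ≃L[ℝ] E) : E →L[ℝ] E) univ L := by
    intro x _ y _
    have := hU.dist_le_mul x y
    rw [dist_eq_norm, dist_eq_norm] at this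
    have h2 : x + U x - (y + U y) - (x - y) = U x - U y := by abel
    simpa [h2] using this
  have hc : Subsingleton E ∨ L < ‖((ContinuousLinearEquiv.refl ℝ E).symm : E →L[ℝ] E)‖₊⁻¹ := by
    rcases subsingleton_or_nontrivial E with h | h
    · exact Or.inl h
    · right
      have : ‖((ContinuousLinearEquiv.refl ℝ E).symm : E →L[ℝ] E)‖₊ = 1 := by
        ext; exact ContinuousLinearMap.norm_id
      rw [this, inv_one]; exact hL
  have hinj : Function.Injective fun x => x + U x := injOn_univ.1 (happ.injOn hc)
  have hsurj := happ.surjective hc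
  refine BijOn.congr (f₁ := fun x => x + U x) ⟨?_, hinj.injOn, ?_⟩ ?_
  · intro x hx
    by_contra hcon
    rw [mem_closedBall_zero_iff] at hx hcon
    have := hinj (a₁ := x + U x) (a₂ := x) (by simp [hUout _ hcon])
    exact hcon (by simpa only [this] using hx)
  · intro y hy
    obtain ⟨x, hx⟩ := hsurj y
    refine ⟨x, ?_, hx⟩
    by_contra hcon
    rw [mem_closedBall_zero_iff] at hcon
    have h2 : x = y := by simpa [hUout _ hcon] using hx
    rw [h2] at hcon
    exact hcon (mem_closedBall_zero_iff.1 hy)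
  · intro x hx
    simp [hUin x (mem_closedBall_zero_iff.1 hx)]

/-- There is no continuously differentiable retraction of the unit ball onto its boundary. -/
theorem not_exists_contDiff_retraction (r : E → E)
    (hr : ∀ x ∈ closedBall (0 : E) 1, ContDiffAt ℝ 1 r x)
    (hfix : ∀ x, ‖x‖ = 1 → r x = x) (hnorm : ∀ x ∈ closedBall (0 : E) 1, ‖r x‖ = 1) : False := by
  borelize E
  let D := closedBall (0 : E) 1
  have hDc : IsCompact D := isCompact_closedBall _ _
  have hd : ∀ x ∈ D, HasFDerivAt r (fderiv ℝ r x) x := fun x hx =>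
    ((hr x hx).differentiableAt one_ne_zero).hasFDerivAt
  let A : E → E →L[ℝ] E := fun x => fderiv ℝ r x - 1
  have hAc : ContinuousOn A D := fun x hx =>
    (((hr x hx).fderiv_right (m := 0) (by simp)).continuousAt.sub continuousAt_const).continuousWithinAt
  obtain ⟨C, hC⟩ := hDc.exists_bound_of_continuousOn hAc
  let L : NNReal := (max C 0).toNNReal
  have hAL : ∀ x ∈ D, ‖A x‖ ≤ L := fun x hx => (hC x hx).trans (by simp [L])
  let u : E → E := fun x => r x - x
  have hud : ∀ x ∈ D, HasFDerivWithinAt u (A x) D x := fun x hx =>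
    ((hd x hx).sub (hasFDerivAt_id x)).hasFDerivWithinAt
  have huL : LipschitzOnWith L u D :=
    (convex_closedBall (0 : E) 1).lipschitzOnWith_of_nnnorm_hasFDerivWithin_le hud
      (fun x hx => hAL x hx)
  have hu1 : ∀ x, ‖x‖ = 1 → u x = 0 := fun x hx => by simp [u, hfix x hx]
  let ε : ℝ := 1 / (L + 1)
  have hL0 : (0 : ℝ) ≤ L := L.2
  have hε : 0 < ε := by positivity
  have hsmall : ∀ t : ℝ, 0 < t → t ≤ ε → t * L < 1 := by
    intro t ht htε
    calc t * L ≤ ε * L := by gcongr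
      _ < 1 := by
        simp only [ε]
        rw [div_mul_eq_mul_div, one_mul, div_lt_one (by positivity)]
        linarith
  have hdetc : ∀ t : ℝ, ContinuousOn (fun x => (1 + t • A x).det) D := fun t =>
    ContinuousLinearMap.continuous_det.comp_continuousOn
      (continuousOn_const.add (hAc.const_smul t))
  -- For small `t`, `x + t • u x` permutes the ball with positive Jacobian, so change of variables
  -- applies.
  have hvol : ∀ t : ℝ, 0 < t → t ≤ ε →
      ∫ x in D, (1 + t • A x).det = (volume : Measure E).real D := by
    intro t ht htε
    have hbij := bijOn_closedBall_add_of_lipschitz (u := fun x => t • u x) (L := t.toNNReal * L)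
      (by
        refine LipschitzOnWith.of_dist_le_mul fun x hx y hy => ?_
        have := huL.dist_le_mul x hx y hy
        rw [dist_smul₀, Real.norm_of_nonneg ht.le]
        rw [NNReal.coe_mul, Real.coe_toNNReal _ ht.le, mul_assoc]
        exact mul_le_mul_of_nonneg_left this ht.le)
      (fun x hx => by simp [hu1 x hx])
      (by
        have := hsmall t ht htε
        rwa [← NNReal.coe_lt_coe, NNReal.coe_mul, Real.coe_toNNReal _ ht.le, NNReal.coe_one])
    have hcv := lintegral_abs_det_fderiv_eq_addHaar_image (volume : Measure E)
      (measurableSet_closedBall (x := (0 : E)) (ε := 1)) (f := fun x => x + t • u x)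
      (f' := fun x => 1 + t • A x)
      (fun x hx => (hasFDerivWithinAt_id x _).add ((hud x hx).const_smul t)) hbij.injOn
    rw [hbij.image_eq] at hcv
    have hpos : ∀ x ∈ D, 0 < (1 + t • A x).det := fun x hx =>
      ContinuousLinearMap.det_one_add_smul_pos _ t ht.le
        (lt_of_le_of_lt (by gcongr; exact hAL x hx) (hsmall t ht htε))
    rw [integral_eq_lintegral_of_nonneg_ae, Measure.real, ← hcv]
    · congr 1
      refine setLIntegral_congr_fun measurableSet_closedBall fun x hx => ?_
      simp only [abs_of_pos (hpos x hx)]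
    · exact (ae_restrict_iff' measurableSet_closedBall).2 (ae_of_all _ fun x hx => (hpos x hx).le)
    · exact (hdetc t).aestronglyMeasurable measurableSet_closedBall
  obtain ⟨s, v, w, hv, hw, hdet⟩ := exists_nodes_det_one_add (E := E) ε hε
  have h1 : ∫ x in D, (1 + A x).det = (volume : Measure E).real D := by
    rw [funext fun x => hdet (A x), integral_finsetSum]
    · simp only [integral_const_mul]
      rw [Finset.sum_congr rfl fun i _ => by rw [hvol (v i) (hv i).1 (hv i).2],
        ← Finset.sum_mul, hw, one_mul]
    · exact fun i _ => ((hdetc (v i)).integrableOn_compact hDc).const_mul _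
  -- Differentiating `‖r‖² = 1` shows that the range of the derivative is orthogonal to `r x ≠ 0`,
  -- so it is not surjective.
  have hDr : ∀ x ∈ ball (0 : E) 1, (1 + A x).det = 0 := by
    intro x hx
    have hxD := ball_subset_closedBall hx
    have hA : 1 + A x = fderiv ℝ r x := by simp [A]
    rw [hA]
    by_contra hne
    have hsq : HasFDerivAt (fun y => inner ℝ (r y) (r y)) _ x := (hd x hxD).inner ℝ (hd x hxD)
    have hconst : (fun y => inner ℝ (r y) (r y)) =ᶠ[nhds x] fun _ => (1 : ℝ) := by
      filter_upwards [isOpen_ball.mem_nhds hx] with y hy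
      rw [real_inner_self_eq_norm_sq, hnorm y (ball_subset_closedBall hy), one_pow]
    have h0 := hsq.unique ((hasFDerivAt_const (1 : ℝ) x).congr_of_eventuallyEq hconst)
    have hsurj : Function.Surjective (fderiv ℝ r x) :=
      (LinearMap.equivOfDetNeZero ((fderiv ℝ r x : E →L[ℝ] E) : E →ₗ[ℝ] E) hne).surjective
    obtain ⟨y, hy⟩ := hsurj (r x)
    have h2 := congrArg (fun B : E →L[ℝ] ℝ => B y) h0
    simp [hy, hnorm x hxD] at h2
  have h2 : ∫ x in D, (1 + A x).det = 0 := by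
    have hcl : EqOn (fun x => (1 + A x).det) (fun _ => 0) D :=
      EqOn.of_subset_closure (s := ball 0 1) hDr (by simpa using hdetc 1) continuousOn_const
        ball_subset_closedBall (closure_ball (0 : E) one_ne_zero).ge
    rw [setIntegral_congr_fun measurableSet_closedBall hcl, integral_zero]
  rw [h2] at h1
  have h3 : 0 < (volume : Measure E).real D :=
    ENNReal.toReal_pos (measure_closedBall_pos _ _ one_pos).ne' measure_closedBall_lt_top.ne
  linarith

end Brouwer

/-! ### Brouwer's fixed point theorem. -/

section Brouwer

open Metric Set

variable {E : Type*} [NormedAddCommGroup E] [InnerProductSpace ℝ E] [FiniteDimensional ℝ E]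

/-- Without a fixed point, following the ray from `F x` through `x` to the sphere would be a smooth
retraction. The coefficient `c x` is the larger root of `‖x + c • d x‖² = 1`. -/
theorem exists_fixedPoint_closedBall_of_contDiff {F : E → E} (hF : ContDiff ℝ 1 F)
    (hmaps : MapsTo F (closedBall 0 1) (closedBall 0 1)) : ∃ x ∈ closedBall (0 : E) 1, F x = x := by
  by_contra! hne
  let d : E → E := fun x => x - F x
  let p : E → ℝ := fun x => inner ℝ x (d x)
  let q : E → ℝ := fun x => inner ℝ (d x) (d x)
  let disc : E → ℝ := fun x => p x ^ 2 + q x * (1 - ‖x‖ ^ 2)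
  let c : E → ℝ := fun x => (√(disc x) - p x) / q x
  have hdC : ContDiff ℝ 1 d := contDiff_id.sub hF
  have hpC : ContDiff ℝ 1 p := contDiff_id.inner ℝ hdC
  have hqC : ContDiff ℝ 1 q := hdC.inner ℝ hdC
  have hdiscC : ContDiff ℝ 1 disc :=
    (hpC.pow 2).add (hqC.mul (contDiff_const.sub (contDiff_norm_sq ℝ)))
  have hq : ∀ x ∈ closedBall (0 : E) 1, 0 < q x := fun x hx =>
    real_inner_self_pos.2 (sub_ne_zero.2 (hne x hx).symm)
  -- This makes the discriminant positive on the sphere, so the root is smooth there, and gives `c x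
  -- = 0`.
  have hp : ∀ x, ‖x‖ = 1 → 0 < p x := by
    intro x hx
    have hxD : x ∈ closedBall (0 : E) 1 := by simp [hx]
    have h1 := hq x hxD
    have h2 : ‖F x‖ ≤ 1 := mem_closedBall_zero_iff.1 (hmaps hxD)
    simp only [q, p, d, inner_sub_left, inner_sub_right, real_inner_self_eq_norm_sq,
      real_inner_comm x (F x), hx] at h1 ⊢
    nlinarith [norm_nonneg (F x)]
  have hdisc : ∀ x ∈ closedBall (0 : E) 1, 0 < disc x := by
    intro x hx
    have hx1 : ‖x‖ ≤ 1 := mem_closedBall_zero_iff.1 hx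
    rcases hx1.lt_or_eq with h | h
    · have : 0 < q x * (1 - ‖x‖ ^ 2) :=
        mul_pos (hq x hx) (by nlinarith [norm_nonneg x])
      have := sq_nonneg (p x)
      simp only [disc]
      linarith
    · simpa [disc, h] using pow_pos (hp x h) 2
  refine not_exists_contDiff_retraction (fun x => x + c x • d x) (fun x hx => ?_) (fun x hx => ?_)
    (fun x hx => ?_)
  · have hcC : ContDiffAt ℝ 1 c x :=
      (((hdiscC.contDiffAt).sqrt (hdisc x hx).ne').sub hpC.contDiffAt).div hqC.contDiffAt (hq x hx).ne'
    exact contDiffAt_id.add (hcC.smul hdC.contDiffAt)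
  · have : c x = 0 := by simp [c, disc, hx, Real.sqrt_sq (hp x hx).le]
    simp [this]
  · have h1 : ‖x + c x • d x‖ ^ 2 = ‖x‖ ^ 2 + 2 * (c x * p x) + c x ^ 2 * q x := by
      rw [norm_add_sq_real, norm_smul, inner_smul_right, mul_pow, Real.norm_eq_abs, sq_abs,
        ← real_inner_self_eq_norm_sq (d x)]
    have h2 : c x * q x = √(disc x) - p x := div_mul_cancel₀ _ (hq x hx).ne'
    have h3 : √(disc x) ^ 2 = p x ^ 2 + q x * (1 - ‖x‖ ^ 2) := Real.sq_sqrt (hdisc x hx).le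
    have h4 : q x * ‖x + c x • d x‖ ^ 2 = q x * 1 := by
      rw [h1]
      have h5 : √(disc x) = c x * q x + p x := by linarith
      rw [h5] at h3
      linarith
    have h6 := mul_left_cancel₀ (hq x hx).ne' h4
    exact (pow_eq_one_iff_of_nonneg (norm_nonneg _) two_ne_zero).1 h6

theorem exists_fixedPoint_of_continuous_of_norm_le_one {F : E → E} (hF : Continuous F)
    (hmaps : ∀ x, ‖F x‖ ≤ 1) : ∃ x, F x = x := by
  obtain ⟨x₀, hx₀, hmin⟩ := (isCompact_closedBall (0 : E) 1).exists_isMinOn ⟨0, by simp⟩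
    (f := fun x => ‖F x - x‖) (by fun_prop)
  by_contra! hne
  have hm : 0 < ‖F x₀ - x₀‖ := norm_pos_iff.2 (sub_ne_zero.2 (hne x₀))
  set m := ‖F x₀ - x₀‖ with hm'
  have hε : 0 < m / 3 := by positivity
  -- A fixed point of the rescaled `g` is displaced by `F` by less than `m / 3 + m / 3`, below the
  -- minimum `m`.
  obtain ⟨g, hg, hgF, -⟩ := hF.exists_contDiff_approx (ε := fun _ => m / 3) 1 continuous_const
    (fun _ => hε)
  have hgn : ∀ x, ‖g x‖ ≤ 1 + m / 3 := fun x => by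
    have h1 := hgF x
    rw [dist_eq_norm] at h1
    have h2 := norm_sub_norm_le (g x) (F x)
    linarith [hmaps x]
  obtain ⟨x, hx, hxg⟩ := exists_fixedPoint_closedBall_of_contDiff
    (F := fun x => (1 + m / 3)⁻¹ • g x) (contDiff_const.smul hg) (fun x _ => by
      rw [mem_closedBall_zero_iff, norm_smul, norm_inv, Real.norm_of_nonneg (by positivity),
        inv_mul_le_iff₀ (by positivity), mul_one]
      exact hgn x)
  have h1 : g x = (1 + m / 3) • x := by
    rw [← hxg, smul_smul, mul_inv_cancel₀ (by positivity), one_smul, hxg]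
  have h2 : ‖F x - x‖ < m := by
    have h3 : F x - x = -(g x - F x) + (m / 3) • x := by rw [h1, add_smul, one_smul]; abel
    have h4 := hgF x
    rw [dist_eq_norm] at h4
    rw [h3]
    refine (norm_add_le _ _).trans_lt ?_
    rw [norm_neg, norm_smul, Real.norm_of_nonneg hε.le]
    have : ‖x‖ ≤ 1 := mem_closedBall_zero_iff.1 hx
    nlinarith
  exact absurd (hmin hx) (not_le.2 h2)

theorem exists_fixedPoint_stdSimplex {ι : Type*} [Fintype ι] [Nonempty ι] {W : (ι → ℝ) → ι → ℝ}
    (hW : ContinuousOn W (stdSimplex ℝ ι)) (hmaps : MapsTo W (stdSimplex ℝ ι) (stdSimplex ℝ ι)) :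
    ∃ c ∈ stdSimplex ℝ ι, W c = c := by
  let S : (ι → ℝ) → ℝ := fun x => ∑ i, max (x i) 0
  -- A continuous retraction onto the simplex: take positive parts, spread missing mass evenly,
  -- divide out any excess.
  let ρ : (ι → ℝ) → ι → ℝ := fun x i =>
    (max (x i) 0 + max (1 - S x) 0 / Fintype.card ι) / max (S x) 1
  have hS : Continuous S := by fun_prop
  have hpos : ∀ x, 0 < max (S x) 1 := fun x => lt_max_of_lt_right one_pos
  have hρc : Continuous ρ := by
    refine continuous_pi fun i => Continuous.div (by fun_prop) (by fun_prop) fun x => (hpos x).ne'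
  have hρmem : ∀ x, ρ x ∈ stdSimplex ℝ ι := by
    refine fun x => ⟨fun i => by positivity, ?_⟩
    have h1 : ∑ i, (max (x i) 0 + max (1 - S x) 0 / Fintype.card ι) = max (S x) 1 := by
      rw [Finset.sum_add_distrib, Finset.sum_const, Finset.card_univ, nsmul_eq_mul,
        mul_div_cancel₀ _ (by exact_mod_cast Fintype.card_ne_zero)]
      change S x + _ = _
      rcases le_total (S x) 1 with h | h
      · rw [max_eq_left (by linarith), max_eq_right h]; ring
      · rw [max_eq_right (by linarith), max_eq_left h]; ring
    simp only [ρ]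
    rw [← Finset.sum_div, h1, div_self (hpos x).ne']
  have hρid : ∀ x ∈ stdSimplex ℝ ι, ρ x = x := by
    intro x hx
    have h1 : ∀ i, max (x i) 0 = x i := fun i => max_eq_left (hx.1 i)
    have h2 : S x = 1 := by simp only [S, h1, hx.2]
    funext i
    simp [ρ, h1, h2]
  let F : EuclideanSpace ℝ ι → EuclideanSpace ℝ ι := fun x => WithLp.toLp 2 (W (ρ x.ofLp))
  have hFc : Continuous F :=
    (PiLp.continuous_toLp 2 _).comp
      (hW.comp_continuous (hρc.comp (PiLp.continuous_ofLp 2 _)) fun x => hρmem _)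
  have hFn : ∀ x, ‖F x‖ ≤ 1 := by
    intro x
    have hm := hmaps (hρmem x.ofLp)
    rw [EuclideanSpace.norm_eq, Real.sqrt_le_one, ← hm.2]
    refine Finset.sum_le_sum fun i _ => ?_
    have h0 := hm.1 i
    have h1 : W (ρ x.ofLp) i ≤ 1 := hm.2 ▸ Finset.single_le_sum (fun j _ => hm.1 j) (Finset.mem_univ i)
    simp only [F, Real.norm_eq_abs, sq_abs]
    nlinarith
  obtain ⟨x, hx⟩ := exists_fixedPoint_of_continuous_of_norm_le_one hFc hFn
  have hx' : W (ρ x.ofLp) = x.ofLp := congrArg WithLp.ofLp hx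
  have hmem : x.ofLp ∈ stdSimplex ℝ ι := hx' ▸ hmaps (hρmem x.ofLp)
  exact ⟨x.ofLp, hmem, by rwa [hρid _ hmem] at hx'⟩

end Brouwer

/-! ### Schauder's fixed point theorem. -/

section Schauder

open Metric Set Filter Topology

variable {V : Type*} [NormedAddCommGroup V] [NormedSpace ℝ V]

/-- Approximate fixed points of a map with relatively compact range, via the Schauder projection. -/
theorem exists_dist_lt_of_mapsTo_isCompact {B K : Set V} (hB : Convex ℝ B) (hne : B.Nonempty)
    {φ : V → V} (hφ : ContinuousOn φ B) (hK : IsCompact K) (hmaps : MapsTo φ B K) (hKB : K ⊆ B)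
    {ε : ℝ} (hε : 0 < ε) : ∃ x ∈ B, dist (φ x) x < ε := by
  obtain ⟨t, htK, htcov⟩ := hK.elim_finite_subcover_image (b := K) (c := fun y => ball y ε)
    (fun _ _ => isOpen_ball) (fun y hy => mem_biUnion hy (mem_ball_self hε))
  obtain ⟨htfin, htcov⟩ := htcov
  have : Fintype t := htfin.fintype
  have : Nonempty t := by
    obtain ⟨b, hb⟩ := hne
    obtain ⟨y, hy, -⟩ := mem_iUnion₂.1 (htcov (hmaps hb))
    exact ⟨⟨y, hy⟩⟩
  let w : V → t → ℝ := fun z y => max (ε - dist z y) 0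
  let s : V → ℝ := fun z => ∑ y, w z y
  have hw0 : ∀ z y, 0 ≤ w z y := fun z y => le_max_right _ _
  have hwc : Continuous w := by fun_prop
  have hsc : Continuous s := by fun_prop
  have hs : ∀ z ∈ K, 0 < s z := by
    intro z hz
    obtain ⟨y, hy, hzy⟩ := mem_iUnion₂.1 (htcov hz)
    refine Finset.sum_pos' (fun y _ => hw0 z y) ⟨⟨y, hy⟩, Finset.mem_univ _, ?_⟩
    exact lt_max_of_lt_left (sub_pos.2 hzy)
  let X : (t → ℝ) → V := fun c => ∑ y, c y • (y : V)
  have hXc : Continuous X := by fun_prop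
  have hXB : ∀ c ∈ stdSimplex ℝ t, X c ∈ B := fun c hc =>
    hB.sum_mem (fun y _ => hc.1 y) hc.2 fun y _ => hKB (htK y.2)
  have hXK : ∀ c ∈ stdSimplex ℝ t, φ (X c) ∈ K := fun c hc => hmaps (hXB c hc)
  have hφX : ContinuousOn (fun c => φ (X c)) (stdSimplex ℝ t) := hφ.comp hXc.continuousOn hXB
  -- Brouwer is applied to the coefficients. At a fixed `c` only centres within `ε` of `φ (X c)`
  -- carry weight, so their average `X c` is within `ε` too.
  obtain ⟨c, hc, hfix⟩ := exists_fixedPoint_stdSimplex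
    (W := fun c => (s (φ (X c)))⁻¹ • w (φ (X c)))
    (((hsc.comp_continuousOn hφX).inv₀ fun c hc => (hs _ (hXK c hc)).ne').smul
      (hwc.comp_continuousOn hφX))
    (fun c hc => ⟨fun y => mul_nonneg (inv_nonneg.2 (hs _ (hXK c hc)).le) (hw0 _ _), by
      simp only [Pi.smul_apply, smul_eq_mul]
      rw [← Finset.mul_sum]
      exact inv_mul_cancel₀ (hs _ (hXK c hc)).ne'⟩)
  refine ⟨X c, hXB c hc, ?_⟩
  have hsum : φ (X c) - X c = ∑ y, c y • (φ (X c) - (y : V)) := by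
    simp only [smul_sub, Finset.sum_sub_distrib, ← Finset.sum_smul, hc.2, one_smul, X]
  have hterm : ∀ y, ‖c y • (φ (X c) - (y : V))‖ ≤ c y * ε := by
    intro y
    rw [norm_smul, Real.norm_of_nonneg (hc.1 y)]
    by_cases hy : dist (φ (X c)) y < ε
    · rw [← dist_eq_norm]
      exact mul_le_mul_of_nonneg_left hy.le (hc.1 y)
    · have : c y = 0 := by
        rw [← hfix]
        simp [w, max_eq_right (sub_nonpos.2 (not_lt.1 hy))]
      simp [this]
  obtain ⟨y, hy⟩ : ∃ y, 0 < c y := by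
    by_contra! hcon
    linarith [hc.2, Finset.sum_nonpos fun y (_ : y ∈ Finset.univ) => hcon y]
  have hstrict : ‖c y • (φ (X c) - (y : V))‖ < c y * ε := by
    rw [norm_smul, Real.norm_of_nonneg (hc.1 y), ← dist_eq_norm]
    refine mul_lt_mul_of_pos_left ?_ hy
    by_contra hcon
    have : c y = 0 := by
      rw [← hfix]
      simp [w, max_eq_right (sub_nonpos.2 (not_lt.1 hcon))]
    exact hy.ne' this
  rw [dist_eq_norm, hsum]
  calc _ ≤ ∑ y, ‖c y • (φ (X c) - (y : V))‖ := norm_sum_le _ _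
    _ < ∑ y, c y * ε := Finset.sum_lt_sum (fun y _ => hterm y) ⟨y, Finset.mem_univ _, hstrict⟩
    _ = ε := by rw [← Finset.sum_mul, hc.2, one_mul]

/-- **Schauder's fixed point theorem** for maps into a compact subset of a convex set. -/
theorem exists_fixedPoint_of_mapsTo_isCompact {B K : Set V} (hB : Convex ℝ B) (hne : B.Nonempty)
    {φ : V → V} (hφ : ContinuousOn φ B) (hK : IsCompact K) (hmaps : MapsTo φ B K) (hKB : K ⊆ B) :
    ∃ x ∈ B, φ x = x := by
  choose x hxB hx using fun n : ℕ => exists_dist_lt_of_mapsTo_isCompact hB hne hφ hK hmaps hKB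
    (Nat.one_div_pos_of_nat (α := ℝ) (n := n))
  obtain ⟨z, hz, σ, hσ, hlim⟩ := hK.tendsto_subseq fun n => hmaps (hxB n)
  have hdist : Tendsto (fun n => dist (φ (x (σ n))) (x (σ n))) atTop (𝓝 0) :=
    squeeze_zero (fun _ => dist_nonneg) (fun n => (hx (σ n)).le)
      (tendsto_one_div_add_atTop_nhds_zero_nat.comp hσ.tendsto_atTop)
  have hxz : Tendsto (fun n => x (σ n)) atTop (𝓝 z) := (tendsto_iff_of_dist hdist).1 hlim
  refine ⟨z, hKB hz, tendsto_nhds_unique ?_ hlim⟩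
  exact (hφ z (hKB hz)).tendsto.comp
    (tendsto_nhdsWithin_iff.2 ⟨hxz, Eventually.of_forall fun n => hxB (σ n)⟩)

end Schauder

/-! ### Lomonosov's theorem for commuting operators. -/

section Lomonosov

open Metric Set Filter Topology

variable {Y : Type*} [NormedAddCommGroup Y] [NormedSpace ℂ Y]

/-- The subspace `M` is a nontrivial closed invariant subspace of `f`. -/
def IsNontrivialInvariant (f : Y →L[ℂ] Y) (M : Submodule ℂ Y) : Prop :=
  M ≠ ⊥ ∧ M ≠ ⊤ ∧ IsClosed (M : Set Y) ∧ ∀ x ∈ M, f x ∈ M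

theorem exists_isNontrivialInvariant_of_eigenvector {f h : Y →L[ℂ] Y} (hfh : Commute f h)
    (hscalar : ∀ c : ℂ, h ≠ c • 1) {μ : ℂ} {v : Y} (hv : v ≠ 0) (hμ : h v = μ • v) :
    ∃ M, IsNontrivialInvariant f M := by
  refine ⟨(h - μ • 1 : Y →L[ℂ] Y).ker, ?_, ?_, ContinuousLinearMap.isClosed_ker _, fun x hx => ?_⟩
  · exact (Submodule.ne_bot_iff _).2 ⟨v, by simp [hμ], hv⟩
  · intro htop
    refine hscalar μ (ContinuousLinearMap.ext fun x => ?_)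
    have : x ∈ (h - μ • 1 : Y →L[ℂ] Y).ker := htop ▸ Submodule.mem_top
    simpa [sub_eq_zero] using this
  · have h1 : h x = μ • x := by simpa [sub_eq_zero] using hx
    have h2 : h (f x) = f (h x) := (DFunLike.congr_fun hfh.eq x).symm
    simp [h2, h1]

theorem exists_eigenvector_of_finiteDimensional (h : Y →L[ℂ] Y) {E : Submodule ℂ Y}
    [FiniteDimensional ℂ E] (hE : E ≠ ⊥) (hinv : ∀ x ∈ E, h x ∈ E) :
    ∃ (μ : ℂ) (v : Y), v ≠ 0 ∧ h v = μ • v := by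
  have : Nontrivial E := Submodule.nontrivial_iff_ne_bot.2 hE
  obtain ⟨μ, hμ⟩ := Module.End.exists_eigenvalue ((h : Y →ₗ[ℂ] Y).restrict hinv)
  obtain ⟨v, hv⟩ := hμ.exists_hasEigenvector
  exact ⟨μ, v, by simpa using hv.2, by simpa using congrArg Subtype.val hv.apply_eq_smul⟩

/-- Riesz: the fixed space of a compact operator is finite-dimensional. -/
theorem IsCompactOperator.finiteDimensional_ker_sub_one {T : Y →L[ℂ] Y}
    (hT : IsCompactOperator T) : FiniteDimensional ℂ (T - 1 : Y →L[ℂ] Y).ker := by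
  set E := (T - 1 : Y →L[ℂ] Y).ker
  have hEc : IsClosed (E : Set Y) := ContinuousLinearMap.isClosed_ker _
  obtain ⟨K, hK, hTK⟩ := IsCompactOperator.image_closedBall_subset_compact
    (f := (T : Y →ₗ[ℂ] Y)) hT 1
  refine FiniteDimensional.of_isCompact_closedBall ℂ one_pos (c := (0 : E)) ?_
  -- On `E` the operator is the identity, so the unit ball of `E` lies in the compact set `K`.
  refine (hEc.isClosedEmbedding_subtypeVal.isCompact_preimage hK).of_isClosed_subset
    isClosed_closedBall fun x hx => hTK ⟨x, by simpa using hx, ?_⟩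
  have hx2 := x.2
  simpa [E, sub_eq_zero] using hx2

/-- The closure of the orbit of `y` under the commutant of `h` is `f`-invariant, because `f` lies in
that commutant, and contains `y`; so it must be everything. -/
theorem exists_commute_apply_mem_of_forall_not_isNontrivialInvariant {f h : Y →L[ℂ] Y}
    (hfh : Commute f h) (hno : ∀ M, ¬ IsNontrivialInvariant f M) {y : Y} (hy : y ≠ 0) {U : Set Y}
    (hU : IsOpen U) (hne : U.Nonempty) : ∃ a : Y →L[ℂ] Y, Commute h a ∧ a y ∈ U := by
  set N := (Subalgebra.toSubmodule (Subalgebra.centralizer ℂ {h})).map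
    (ContinuousLinearMap.apply ℂ Y y : (Y →L[ℂ] Y) →ₗ[ℂ] Y)
  have hmem : ∀ z, z ∈ N ↔ ∃ a : Y →L[ℂ] Y, Commute h a ∧ a y = z := by
    intro z
    simp [N, Subalgebra.mem_centralizer_iff, Commute, SemiconjBy]
  have htop : N.topologicalClosure = ⊤ := by
    by_contra htop
    refine hno N.topologicalClosure ⟨?_, htop, N.isClosed_topologicalClosure, ?_⟩
    · exact (Submodule.ne_bot_iff _).2
        ⟨y, N.le_topologicalClosure ((hmem y).2 ⟨1, Commute.one_right _, rfl⟩), hy⟩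
    · intro x hx
      refine map_mem_closure f.continuous hx fun z hz => ?_
      obtain ⟨a, ha, rfl⟩ := (hmem z).1 hz
      exact (hmem _).2 ⟨f * a, hfh.symm.mul_right ha, rfl⟩
  have hdense : Dense (N : Set Y) := Submodule.dense_iff_topologicalClosure_eq_top.2 htop
  obtain ⟨z, hz, hzN⟩ := hdense.inter_open_nonempty U hU hne
  obtain ⟨a, ha, rfl⟩ := (hmem z).1 hzN
  exact ⟨a, ha, hz⟩

/-- Lomonosov's lemma: if the commutant of `h` acts transitively, some `a` in it is such that
`a k` has a nonzero fixed vector. -/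
theorem exists_commute_fixed_vector {h k : Y →L[ℂ] Y} (hk0 : k ≠ 0) (hk : IsCompactOperator k)
    (htrans : ∀ y : Y, y ≠ 0 → ∀ U : Set Y, IsOpen U → U.Nonempty →
      ∃ a : Y →L[ℂ] Y, Commute h a ∧ a y ∈ U) :
    ∃ (a : Y →L[ℂ] Y) (z : Y), Commute h a ∧ z ≠ 0 ∧ a (k z) = z := by
  obtain ⟨y₀, hy₀⟩ : ∃ y, k y ≠ 0 := by
    by_contra! hcon
    exact hk0 (ContinuousLinearMap.ext hcon)
  have hk0' : 0 < ‖k y₀‖ := norm_pos_iff.2 hy₀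
  obtain ⟨r, hr, hball⟩ := Metric.continuousAt_iff.1 (k.continuous.continuousAt (x := y₀)) (‖k y₀‖ / 2)
    (half_pos hk0')
  let B := closedBall y₀ (r / 2)
  have hkB : ∀ x ∈ B, ‖k y₀‖ / 2 ≤ ‖k x‖ := by
    intro x hx
    have h1 := hball (lt_of_le_of_lt hx (half_lt_self hr))
    rw [dist_comm, dist_eq_norm] at h1
    linarith [norm_sub_norm_le (k y₀) (k x)]
  have hB0 : ∀ x ∈ B, x ≠ 0 := by
    rintro x hx rfl
    have := hkB 0 hx
    rw [map_zero, norm_zero] at this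
    linarith
  obtain ⟨K₀, hK₀, hkK₀⟩ := IsCompactOperator.image_subset_compact_of_bounded
    (f := (k : Y →ₗ[ℂ] Y)) hk (isBounded_closedBall (x := y₀) (r := r / 2))
  -- Compact, contains `k '' B` and avoids `0`, so every point of it can be sent into the ball
  -- around `y₀`.
  let K := K₀ ∩ {y | ‖k y₀‖ / 2 ≤ ‖y‖}
  have hK : IsCompact K := hK₀.inter_right (isClosed_le continuous_const continuous_norm)
  have hkK : MapsTo k B K := fun x hx => ⟨hkK₀ ⟨x, hx, rfl⟩, hkB x hx⟩
  have hr2 : 0 < r / 2 := half_pos hr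
  obtain ⟨t, ht⟩ := hK.elim_finite_subcover
    (fun a : {a : Y →L[ℂ] Y // Commute h a} => (a : Y →L[ℂ] Y) ⁻¹' ball y₀ (r / 2))
    (fun a => isOpen_ball.preimage a.1.continuous) (fun y hy => by
      have hy0 : y ≠ 0 := by
        rintro rfl
        have := hy.2
        rw [mem_ofPred_eq, norm_zero] at this
        linarith
      obtain ⟨a, ha, hay⟩ := htrans y hy0 _ isOpen_ball (nonempty_ball.2 hr2)
      exact mem_iUnion.2 ⟨⟨a, ha⟩, hay⟩)
  let w : {a : Y →L[ℂ] Y // Commute h a} → Y → ℝ := fun a y => max (r / 2 - dist (a.1 y) y₀) 0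
  let s : Y → ℝ := fun y => ∑ a ∈ t, w a y
  have hw0 : ∀ a y, 0 ≤ w a y := fun a y => le_max_right _ _
  have hwc : ∀ a, Continuous (w a) := fun a => by fun_prop
  have hsc : Continuous s := by fun_prop
  have hs : ∀ y ∈ K, 0 < s y := by
    intro y hy
    obtain ⟨a, ha, hay⟩ := mem_iUnion₂.1 (ht hy)
    exact Finset.sum_pos' (fun a _ => hw0 a y) ⟨a, ha, lt_max_of_lt_left (sub_pos.2 hay)⟩
  -- A convex combination using only those `a` that send `y` into the ball, hence `ψ` maps `K` to
  -- `B`.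
  let ψ : Y → Y := fun y => ∑ a ∈ t, ((s y)⁻¹ * w a y) • a.1 y
  have hψc : ContinuousOn ψ K := by
    refine continuousOn_finsetSum _ fun a _ => ?_
    have hc : ContinuousOn (fun y => (s y)⁻¹ * w a y) K :=
      (hsc.continuousOn.inv₀ fun y hy => (hs y hy).ne').mul (hwc a).continuousOn
    exact hc.smul a.1.continuous.continuousOn
  have hψB : MapsTo ψ K B := by
    intro y hy
    have hterm : ψ y - y₀ = ∑ a ∈ t, ((s y)⁻¹ * w a y) • (a.1 y - y₀) := by
      simp only [smul_sub, Finset.sum_sub_distrib, ← Finset.sum_smul, ← Finset.mul_sum]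
      rw [show ∑ a ∈ t, w a y = s y from rfl, inv_mul_cancel₀ (hs y hy).ne', one_smul]
    rw [mem_closedBall, dist_eq_norm, hterm]
    calc _ ≤ ∑ a ∈ t, ‖((s y)⁻¹ * w a y) • (a.1 y - y₀)‖ := norm_sum_le _ _
      _ ≤ ∑ a ∈ t, (s y)⁻¹ * w a y * (r / 2) := by
        refine Finset.sum_le_sum fun a _ => ?_
        have h0 : 0 ≤ (s y)⁻¹ * w a y := mul_nonneg (inv_nonneg.2 (hs y hy).le) (hw0 a y)
        rw [norm_smul, Real.norm_of_nonneg h0, ← dist_eq_norm]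
        by_cases had : dist (a.1 y) y₀ ≤ r / 2
        · exact mul_le_mul_of_nonneg_left had h0
        · have : w a y = 0 := max_eq_right (by linarith)
          simp [this]
      _ = r / 2 := by
        rw [← Finset.sum_mul, ← Finset.mul_sum, show ∑ a ∈ t, w a y = s y from rfl,
          inv_mul_cancel₀ (hs y hy).ne', one_mul]
  obtain ⟨z, hzB, hz⟩ := exists_fixedPoint_of_mapsTo_isCompact (convex_closedBall y₀ (r / 2))
    ⟨y₀, mem_closedBall_self hr2.le⟩ (φ := fun x => ψ (k x)) (K := ψ '' K)
    (hψc.comp k.continuous.continuousOn hkK) (hK.image_of_continuousOn hψc)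
    (fun x hx => mem_image_of_mem ψ (hkK hx)) (image_subset_iff.2 hψB)
  -- Freezing the weights at `k z` turns the nonlinear `ψ` into an operator in the commutant.
  refine ⟨∑ a ∈ t, ((s (k z))⁻¹ * w a (k z)) • a.1, z, ?_, hB0 z hzB, ?_⟩
  · exact Commute.sum_right _ _ _ fun a _ => a.2.smul_right _
  · simpa [ψ, sum_apply] using hz

/-- **Lomonosov's invariant subspace theorem**. -/
theorem exists_isNontrivialInvariant_of_commute {f h k : Y →L[ℂ] Y} (hfh : Commute f h)
    (hhk : Commute h k) (hscalar : ∀ c : ℂ, h ≠ c • 1) (hk0 : k ≠ 0) (hk : IsCompactOperator k) :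
    ∃ M, IsNontrivialInvariant f M := by
  by_contra! hno
  obtain ⟨a, z, ha, hz0, hz⟩ := exists_commute_fixed_vector (h := h) hk0 hk fun y hy U hU hne =>
    exists_commute_apply_mem_of_forall_not_isNontrivialInvariant hfh hno hy hU hne
  have hak : IsCompactOperator (a * k : Y →L[ℂ] Y) := hk.clm_comp a
  have := hak.finiteDimensional_ker_sub_one
  obtain ⟨μ, v, hv, hμ⟩ := exists_eigenvector_of_finiteDimensional h
    (E := (a * k - 1 : Y →L[ℂ] Y).ker)
    ((Submodule.ne_bot_iff _).2 ⟨z, by simp [hz], hz0⟩) (fun x hx => by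
      have h1 : a (k x) = x := by simpa [sub_eq_zero] using hx
      have h2 := DFunLike.congr_fun (ha.mul_right hhk).eq x
      change h (a (k x)) = a (k (h x)) at h2
      rw [h1] at h2
      simp [← h2])
  obtain ⟨M, hM⟩ := exists_isNontrivialInvariant_of_eigenvector hfh hscalar hv hμ
  exact hno M hM

end Lomonosov

/-! ### From linear relations to operators. -/

section Reduction

theorem mcomp_singleton_left {X Y Z : Type*} (g : Y → Z) (F : X → Set Y) (x : X) :
    mcomp (fun y => {g y}) F x = g '' F x := by
  ext z
  simp [mcomp, eq_comm]

theorem mcomp_singleton_right {X Y Z : Type*} (G : Y → Set Z) (f : X → Y) (x : X) :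
    mcomp G (fun y => {f y}) x = G (f x) := by
  simp [mcomp]

namespace LinRel

section Algebra

variable {𝕜 X Y : Type*} [Field 𝕜] [AddCommGroup X] [Module 𝕜 X] [AddCommGroup Y] [Module 𝕜 Y]

theorem mem_zeroValue {T : LinRel 𝕜 X Y} {y : Y} : y ∈ T.zeroValue ↔ y ∈ T 0 := Iff.rfl

theorem comb_mem (T : LinRel 𝕜 X Y) {x y : X} {u v : Y} (hu : u ∈ T x) (hv : v ∈ T y) {a b : 𝕜}
    (ha : a ≠ 0) (hb : b ≠ 0) : a • u + b • v ∈ T (a • x + b • y) := by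
  rw [T.map_comb' x y a b ha hb]
  exact Set.add_mem_add (Set.smul_mem_smul_set hu) (Set.smul_mem_smul_set hv)

theorem exists_linearMap_of_zeroValue_eq_bot (T : LinRel 𝕜 X Y) (hT : T.zeroValue = ⊥) :
    ∃ g : X →ₗ[𝕜] Y, ∀ x, T x = {g x} := by
  have h0 : ∀ u ∈ T 0, u = 0 := fun u hu => (Submodule.mem_bot 𝕜).1 (hT ▸ mem_zeroValue.2 hu)
  have h00 : (0 : Y) ∈ T 0 := T.zeroValue.zero_mem
  have huniq : ∀ x, ∀ u ∈ T x, ∀ v ∈ T x, u = v := by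
    intro x u hu v hv
    have h1 := T.comb_mem hu hv one_ne_zero (neg_ne_zero.2 (one_ne_zero (α := 𝕜)))
    simp only [one_smul, neg_smul, add_neg_cancel] at h1
    exact add_neg_eq_zero.1 (h0 _ h1)
  choose g hg using T.nonempty'
  refine ⟨{ toFun := g, map_add' := fun x y => ?_, map_smul' := fun c x => ?_ }, fun x =>
    Set.eq_singleton_iff_unique_mem.2 ⟨hg x, fun u hu => huniq x u hu _ (hg x)⟩⟩
  · have h1 := T.comb_mem (hg x) (hg y) (one_ne_zero (α := 𝕜)) (one_ne_zero (α := 𝕜))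
    simp only [one_smul] at h1
    exact huniq _ _ (hg _) _ h1
  -- The axiom covers only nonzero coefficients, so `c = 0` uses `T 0 = {0}`.
  · rcases eq_or_ne c 0 with rfl | hc
    · rw [zero_smul, RingHom.id_apply, zero_smul]
      exact h0 _ (hg 0)
    · have h1 := T.comb_mem (hg x) h00 hc (one_ne_zero (α := 𝕜))
      simp only [smul_zero, add_zero] at h1
      exact huniq _ _ (hg _) _ h1

end Algebra

section Normed

variable {𝕜 X Y : Type*} [NontriviallyNormedField 𝕜] [NormedAddCommGroup X] [NormedSpace 𝕜 X]
  [NormedAddCommGroup Y] [NormedSpace 𝕜 Y]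

theorem exists_continuousLinearMap_of_zeroValue_eq_bot (T : LinRel 𝕜 X Y)
    (hT : T.zeroValue = ⊥) (husc : IsUSC T) : ∃ g : X →L[𝕜] Y, ∀ x, T x = {g x} := by
  obtain ⟨g, hg⟩ := T.exists_linearMap_of_zeroValue_eq_bot hT
  refine ⟨⟨g, Metric.continuous_iff.2 fun x ε hε => ?_⟩, hg⟩
  obtain ⟨δ, hδ, h⟩ := husc x ε hε
  refine ⟨δ, hδ, fun y hy => ?_⟩
  have h1 := h y hy
  rw [hg, hg, Metric.thickening_singleton, Set.singleton_subset_iff] at h1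
  exact h1

theorem IsCompactRel.isCompactOperator {T : LinRel 𝕜 X Y} (hT : T.IsCompactRel)
    (h0 : T.zeroValue = ⊥) {g : X → Y} (hg : ∀ x, T x = {g x}) : IsCompactOperator g := by
  obtain ⟨C, hC, hsub⟩ := hT (Metric.ball 0 1) Metric.isBounded_ball
  let e : (Y ⧸ T.zeroValue) →ₗ[𝕜] Y := T.zeroValue.liftQ LinearMap.id (by simp [h0])
  have he : Continuous e := continuous_quot_lift _ continuous_id
  refine ⟨e '' C, hC.image he, Filter.mem_of_superset (Metric.ball_mem_nhds 0 one_pos) ?_⟩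
  intro x hx
  refine ⟨T.zeroValue.mkQ (g x), hsub ⟨g x, Set.mem_biUnion hx (by simp [hg]), rfl⟩, rfl⟩

end Normed

end LinRel

variable {Y : Type*} [NormedAddCommGroup Y] [NormedSpace ℂ Y]

/-- If `h(0) ≠ 0`, then `h(0)` itself is a nontrivial closed invariant subspace. -/
theorem isNontrivialInvariant_zeroValue {h k : LinRel ℂ Y Y}
    (h_sel : ∀ c : ℂ, ¬ IsSelection (fun x : Y => c • x) h)
    (hk : FiniteDimensional ℂ k.zeroValue) {f : Y →L[ℂ] Y}
    (hfh : ∀ x, h (f x) = f '' h x) (hf : h 0 ⊆ f '' k 0) (h0 : h.zeroValue ≠ ⊥) :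
    IsNontrivialInvariant f h.zeroValue := by
  have hle : h.zeroValue ≤ k.zeroValue.map (f : Y →ₗ[ℂ] Y) := fun y hy => hf hy
  have : FiniteDimensional ℂ h.zeroValue := Submodule.finiteDimensional_of_le hle
  refine ⟨h0, fun htop => h_sel 0 fun x => ?_, h.zeroValue.closed_of_finiteDimensional,
    fun x hx => ?_⟩
  -- If `h 0` were everything, `0 = u + (-u)` would lie in every `h x`, making the zero map a
  -- selection.
  · obtain ⟨u, hu⟩ := h.nonempty' x
    have hu0 : -u ∈ h 0 := LinRel.mem_zeroValue.1 (htop ▸ Submodule.mem_top)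
    simpa using h.comb_mem hu hu0 (one_ne_zero (α := ℂ)) (one_ne_zero (α := ℂ))
  · have h1 := hfh 0
    rw [map_zero] at h1
    exact LinRel.mem_zeroValue.2 (h1 ▸ Set.mem_image_of_mem f hx)

end Reduction

/-! ### The invariant subspace theorem for relations. -/

theorem mainTheorem3 {Y : Type*} [NormedAddCommGroup Y] [NormedSpace ℂ Y]
    (h : LinRel ℂ Y Y) (h_usc : IsUSC h)
    (h_sel : ∀ c : ℂ, ¬ IsSelection (fun x : Y => c • x) h)
    (k : LinRel ℂ Y Y) (k_comm : k ∈ LinRel.Comm h) (k_compact : k.IsCompactRel)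
    (k_ker : mpreimage k {0} ≠ Set.univ)
    (f : Y →L[ℂ] Y) (f_comm : MStrictlyCommute (fun y : Y => {f y}) h)
    (hf : h 0 ⊆ mcomp (fun y : Y => {f y}) k 0) :
    ∃ M : Submodule ℂ Y, M ≠ ⊥ ∧ M ≠ ⊤ ∧ IsClosed (M : Set Y) ∧ ∀ x ∈ M, f x ∈ M := by
  obtain ⟨⟨k_usc, -, k_fin⟩, hk⟩ := k_comm
  have hfh : ∀ x, h (f x) = f '' h x := fun x => by
    rw [← mcomp_singleton_left, ← mcomp_singleton_right h f]
    exact congrFun f_comm x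
  by_cases h0 : h.zeroValue = ⊥
  swap
  · exact ⟨_, isNontrivialInvariant_zeroValue h_sel k_fin hfh
      (by rwa [← mcomp_singleton_left]) h0⟩
  obtain ⟨H, hH⟩ := h.exists_continuousLinearMap_of_zeroValue_eq_bot h0 h_usc
  have hfH : Commute f H := ContinuousLinearMap.ext fun x => by
    have h1 := hfh x
    rw [hH, hH, Set.image_singleton, Set.singleton_eq_singleton_iff] at h1
    exact h1.symm
  have hscalar : ∀ c : ℂ, H ≠ c • 1 := fun c hc => h_sel c fun x => by simp [hH, hc]
  have hHk : ∀ x, ∀ y ∈ k x, H y ∈ k (H x) := fun x y hy => by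
    have h1 : H y ∈ mcomp k h x := hk x (Set.mem_biUnion hy (by simp [hH]))
    simpa [mcomp, hH] using h1
  by_cases hk0 : k.zeroValue = ⊥
  · obtain ⟨K, hK⟩ := k.exists_continuousLinearMap_of_zeroValue_eq_bot hk0 k_usc
    refine exists_isNontrivialInvariant_of_commute hfH (k := K)
      (ContinuousLinearMap.ext fun x => ?_) hscalar ?_ (k_compact.isCompactOperator hk0 hK)
    · simpa [hK] using hHk x (K x) (by simp [hK])
    · rintro rfl
      exact k_ker (Set.eq_univ_of_forall fun x => ⟨0, by simp [hK]⟩)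
  -- Commutation at `x = 0`, where `H 0 = 0`, says that `H` preserves `k 0`.
  · obtain ⟨μ, v, hv, hμ⟩ := exists_eigenvector_of_finiteDimensional H hk0 fun y hy => by
      simpa [LinRel.mem_zeroValue] using hHk 0 y hy
    exact exists_isNontrivialInvariant_of_eigenvector hfH hscalar hv hμ
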